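/- Proposition 2.1. For $n\in\mathbb{N}$ let $F_n$ be the free group on a fixed basis of $n$ letters, whose elements are represented by reduced words. There is an algorithm which, given $n$ and a program solving the membership problem of a subgroup $H\le F_n$ (that is, deciding for every $g\in F_n$ whether $g\in H$), produces two programs $P$ and $Q$ for which there is a free basis $B=\{b_0,b_1,b_2,\ldots\}$ of $H$, finite or infinite and listed without repetition, such that: (a) $P$ enumerates $B$ (so $B$ is recursively enumerable): on input $k\in\mathbb{N}$ it halts if and only if $B$ has an element $b_k$ with index $k$, and then its output is $b_k$; (b) on input any $h\in H$, $Q$ halts and outputs a word in the letters $b_k^{\pm1}$, given by the indices $k$ and the exponents $\pm1$, whose value is $h$. -/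

import Mathlib

open Nat.Partrec (Code)

/-- Gödel number of a word on `α ∪ α⁻¹`, where the letter `a ∈ α` is named by the natural number
`ν a`; the pair `(a, true)` stands for `a` and `(a, false)` for `a⁻¹`. -/
def wordCode {α : Type} (ν : α → ℕ) (w : List (α × Bool)) : ℕ :=
  Encodable.encode (w.map fun x => (ν x.1, x.2))

/-- Gödel number of an element of the free group `F_n` on the basis `Fin n`: the Gödel number of
its reduced word. -/
def elemCode {n : ℕ} (g : FreeGroup (Fin n)) : ℕ :=
  wordCode (fun i : Fin n => (i : ℕ)) g.toWord

/-- The program `c` solves the membership problem of `H ≤ F_n`: on (the reduced word of) any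
`g ∈ F_n` it halts, with output `1` if `g ∈ H` and `0` if `g ∉ H`. -/
def DecidesMembership {n : ℕ} (c : Code) (H : Subgroup (FreeGroup (Fin n))) : Prop :=
  ∀ g : FreeGroup (Fin n),
    (g ∈ H → c.eval (elemCode g) = Part.some 1) ∧ (g ∉ H → c.eval (elemCode g) = Part.some 0)

/-- The program `p` enumerates the sequence `(b k)_{k ∈ I}` of elements of `H`: on input `k` it
halts if and only if `k ∈ I`, and then its output is (the reduced word of) `b k`. -/
def EnumeratesSeq {n : ℕ} {H : Subgroup (FreeGroup (Fin n))} (p : Code) (I : Set ℕ)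
    (b : I → H) : Prop :=
  (∀ k : ℕ, (p.eval k).Dom ↔ k ∈ I) ∧
    ∀ k : I, p.eval k = Part.some (elemCode (b k : FreeGroup (Fin n)))

/-- The program `q` expresses the elements of `H` as words on the sequence `(b k)_{k ∈ I}`: on
(the reduced word of) any `h ∈ H` it halts, and its output is a word `v` in the letters
`k ∈ I` and their formal inverses which takes the value `h` when each `k` is replaced by `b k`. -/
def ExpressesIn {n : ℕ} {H : Subgroup (FreeGroup (Fin n))} (q : Code) (I : Set ℕ)
    (b : I → H) : Prop :=
  ∀ h : H, ∃ v : List (I × Bool),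
    q.eval (elemCode (h : FreeGroup (Fin n))) = Part.some (wordCode (fun k : I => (k : ℕ)) v) ∧
      FreeGroup.lift b (FreeGroup.mk v) = h

/-! The basis is Schreier's: for a transversal `t` spanning a tree in the Schreier graph, the
nontrivial elements `t(xc)⁻¹ x t(c)` generate `H` freely. For freeness, the free group on the
non-tree edges is glued to the graph: `F` acts on pairs (coset, label), each edge multiplying the
label by its own generator, and a word `u` in the generators shifts the labels over the base coset
by `u` (`perm_hom`). Generation is Reidemeister rewriting (`transversal_mul_hom_rewrite`).

To make this effective, each coset is represented by its word of least Gödel number. The code of `x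
:: w` increases with the code of `w`, so these words are closed under suffixes (`rep_of_cons`) and
span a tree. A membership program tests equality of cosets, so representatives are found by search,
edges become decidable, and an edge is indexed by counting the smaller edge codes. All procedures
are partial recursive uniformly in `n` and the membership program, and currying turns them into
programs. -/

/-! ### Schreier's theorem for a transversal that spans a tree. -/

/-- A transversal `t` of the left cosets of `H` whose values are connected to `1` along the edges
`g — xg` of the Cayley graph that join two values of `t`. -/
structure IsSchreierTransversal {α : Type} {H : Subgroup (FreeGroup α)}
    (t : FreeGroup α ⧸ H → FreeGroup α) : Prop where
  mk_eq : ∀ c, (t c : FreeGroup α ⧸ H) = c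
  one : t ((1 : FreeGroup α) : FreeGroup α ⧸ H) = 1
  tree : ∀ P : FreeGroup α ⧸ H → Prop, P ((1 : FreeGroup α) : FreeGroup α ⧸ H) →
    (∀ c a, t (FreeGroup.of a • c) = FreeGroup.of a * t c → (P c ↔ P (FreeGroup.of a • c))) →
    ∀ c, P c

namespace IsSchreierTransversal

variable {α : Type} {H : Subgroup (FreeGroup α)} {t : FreeGroup α ⧸ H → FreeGroup α}
  (ht : IsSchreierTransversal t)

/-- The Schreier generator of `H` given by the edge from `c` to `x_a c`. -/
def gen (e : (FreeGroup α ⧸ H) × α) : H :=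
  ⟨(t (FreeGroup.of e.2 • e.1))⁻¹ * (FreeGroup.of e.2 * t e.1), by
    rw [← QuotientGroup.eq, ht.mk_eq, ← smul_eq_mul, ← MulAction.Quotient.smul_coe, ht.mk_eq]⟩

theorem gen_eq_one_iff (e : (FreeGroup α ⧸ H) × α) :
    ht.gen e = 1 ↔ t (FreeGroup.of e.2 • e.1) = FreeGroup.of e.2 * t e.1 := by
  rw [← Subtype.coe_inj]
  simp [gen, inv_mul_eq_one]

/-- The edges outside the spanning tree. -/
abbrev Edge : Type := {e : (FreeGroup α ⧸ H) × α // ht.gen e ≠ 1}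

open Classical in
/-- The free generator labelling an edge of the Schreier graph, `1` for edges of the tree. -/
noncomputable def label (e : (FreeGroup α ⧸ H) × α) : FreeGroup ht.Edge :=
  if h : ht.gen e ≠ 1 then FreeGroup.of ⟨e, h⟩ else 1

/-- The action of a letter on the labelled Schreier graph. -/
noncomputable def letterPerm (a : α) :
    Equiv.Perm ((FreeGroup α ⧸ H) × FreeGroup ht.Edge) where
  toFun p := (FreeGroup.of a • p.1, ht.label (p.1, a) * p.2)
  invFun p := ((FreeGroup.of a)⁻¹ • p.1, (ht.label ((FreeGroup.of a)⁻¹ • p.1, a))⁻¹ * p.2)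
  left_inv p := by simp
  right_inv p := by simp

/-- The action of the free group on the labelled Schreier graph. -/
noncomputable def perm : FreeGroup α →* Equiv.Perm ((FreeGroup α ⧸ H) × FreeGroup ht.Edge) :=
  FreeGroup.lift ht.letterPerm

theorem perm_of (a : α) (c : FreeGroup α ⧸ H) (w : FreeGroup ht.Edge) :
    ht.perm (FreeGroup.of a) (c, w) = (FreeGroup.of a • c, ht.label (c, a) * w) := by
  simp [perm, letterPerm]

/-- Tree edges carry the label `1`, so moving along the tree from the base coset leaves the
free-group coordinate alone. -/
theorem perm_transversal (c : FreeGroup α ⧸ H) :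
    ∀ w, ht.perm (t c) (((1 : FreeGroup α) : FreeGroup α ⧸ H), w) = (c, w) := by
  refine ht.tree (fun c => ∀ w, ht.perm (t c) (_, w) = (c, w)) ?_ ?_ c
  · simp [ht.one]
  · intro c a h
    have hl : ht.label (c, a) = 1 := by
      rw [label, dif_neg]
      simpa [gen_eq_one_iff] using h
    rw [h]
    refine forall_congr' fun w => ?_
    rw [map_mul, Equiv.Perm.mul_apply]
    have := ht.perm_of a c w
    rw [hl, one_mul] at this
    rw [← this, EmbeddingLike.apply_eq_iff_eq]

theorem perm_gen (e : (FreeGroup α ⧸ H) × α) (w : FreeGroup ht.Edge) :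
    ht.perm (ht.gen e) (((1 : FreeGroup α) : FreeGroup α ⧸ H), w) =
      (((1 : FreeGroup α) : FreeGroup α ⧸ H), ht.label e * w) := by
  simp only [gen, map_mul, map_inv, Equiv.Perm.mul_apply, perm_transversal, perm_of]
  rw [Equiv.Perm.inv_eq_iff_eq, perm_transversal]

/-- The homomorphism from the free group on the edges outside the tree. -/
noncomputable def hom : FreeGroup ht.Edge →* H := FreeGroup.lift fun e => ht.gen e

/-- Evaluating at `w = 1` recovers `u` from its image in `H`, which gives injectivity. -/
theorem perm_hom (u : FreeGroup ht.Edge) :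
    ∀ w, ht.perm (ht.hom u) (((1 : FreeGroup α) : FreeGroup α ⧸ H), w) =
      (((1 : FreeGroup α) : FreeGroup α ⧸ H), u * w) := by
  have hof (e : ht.Edge) (w) :
      ht.perm (ht.gen e) (((1 : FreeGroup α) : FreeGroup α ⧸ H), w) =
        (((1 : FreeGroup α) : FreeGroup α ⧸ H), FreeGroup.of e * w) := by
    rw [perm_gen, label, dif_pos e.2]
  induction u using FreeGroup.induction_on with
  | C1 => simp
  | of e => simpa [hom] using hof e
  | inv_of e _ =>
    intro w
    rw [map_inv, Subgroup.coe_inv, map_inv, Equiv.Perm.inv_eq_iff_eq]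
    simp [hom, hof]
  | mul x y hx hy =>
    intro w
    simp [hx, hy, mul_assoc]

theorem hom_injective : Function.Injective ht.hom := by
  rw [injective_iff_map_eq_one]
  intro u hu
  have := ht.perm_hom u 1
  simpa [hu] using this.symm

/-- The edge of the Schreier graph crossed by the letter `x` when it is applied to the coset
of the word `s`. -/
def crossed (H : Subgroup (FreeGroup α)) (x : α × Bool) (s : List (α × Bool)) :
    (FreeGroup α ⧸ H) × α :=
  (((FreeGroup.mk (bif x.2 then s else x :: s) : FreeGroup α) : FreeGroup α ⧸ H), x.1)

open Classical in
/-- The rewriting of a word as a word on the edges outside the tree. -/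
noncomputable def rewrite : List (α × Bool) → List (ht.Edge × Bool)
  | [] => []
  | x :: s =>
    if h : ht.gen (crossed H x s) ≠ 1 then (⟨crossed H x s, h⟩, x.2) :: rewrite s else rewrite s

theorem hom_mk_cons (e : ht.Edge) (b : Bool) (l : List (ht.Edge × Bool)) :
    ht.hom (FreeGroup.mk ((e, b) :: l)) =
      (bif b then ht.gen e else (ht.gen e)⁻¹) * ht.hom (FreeGroup.mk l) := by
  simp only [hom, FreeGroup.lift_mk, List.map_cons, List.prod_cons]

/-- Letters act on the left, so the word is read from its right end; each letter replaces the
representative and contributes one Schreier generator or its inverse. For a word in `H` the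
remaining representative is `1`. -/
theorem transversal_mul_hom_rewrite (s : List (α × Bool)) :
    t ((FreeGroup.mk s : FreeGroup α) : FreeGroup α ⧸ H) *
      (ht.hom (FreeGroup.mk (ht.rewrite s)) : FreeGroup α) = FreeGroup.mk s := by
  induction s with
  | nil =>
    simp [rewrite, ← FreeGroup.one_eq_mk, ht.one]
  | cons x s ih =>
    have key : (ht.hom (FreeGroup.mk (ht.rewrite (x :: s))) : FreeGroup α) =
        ((bif x.2 then ht.gen (crossed H x s) else (ht.gen (crossed H x s))⁻¹ : H) :
          FreeGroup α) * ht.hom (FreeGroup.mk (ht.rewrite s)) := by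
      rw [rewrite]
      split_ifs with h
      · rw [hom_mk_cons, Subgroup.coe_mul]
      · rw [not_not] at h
        cases x.2 <;> simp [h]
    rw [key]
    obtain ⟨a, b⟩ := x
    cases b
    -- An inverse letter crosses backwards the edge which starts at the new coset.
    · have h1 : FreeGroup.of a * FreeGroup.mk ((a, false) :: s) = FreeGroup.mk s := by
        rw [FreeGroup.of, FreeGroup.mul_mk]
        exact Quot.sound (FreeGroup.Red.Step.cons_not (b := true))
      simp only [crossed, gen, cond_false, Subgroup.coe_inv, MulAction.Quotient.smul_coe,
        smul_eq_mul, h1]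
      rw [mul_inv_rev, inv_inv, mul_assoc, ih, mul_inv_rev, ← h1]
      group
    · have h1 : FreeGroup.of a * FreeGroup.mk s = FreeGroup.mk ((a, true) :: s) := by
        rw [FreeGroup.of, FreeGroup.mul_mk]; rfl
      simp only [crossed, gen, cond_true, MulAction.Quotient.smul_coe, smul_eq_mul, h1]
      rw [mul_assoc, mul_assoc, ih, h1]
      group

theorem hom_rewrite {s : List (α × Bool)} (hs : FreeGroup.mk s ∈ H) :
    (ht.hom (FreeGroup.mk (ht.rewrite s)) : FreeGroup α) = FreeGroup.mk s := by
  have h1 : ((FreeGroup.mk s : FreeGroup α) : FreeGroup α ⧸ H) = (1 : FreeGroup α) :=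
    ((QuotientGroup.eq).2 (by simpa using hs)).symm
  simpa [h1, ht.one] using ht.transversal_mul_hom_rewrite s

theorem hom_surjective : Function.Surjective ht.hom := by
  rintro ⟨⟨s⟩, hs⟩
  exact ⟨_, Subtype.ext (ht.hom_rewrite hs)⟩

/-- The Schreier basis. -/
noncomputable def basis : FreeGroupBasis ht.Edge H :=
  .ofRepr (MulEquiv.ofBijective ht.hom ⟨ht.hom_injective, ht.hom_surjective⟩).symm

theorem basis_apply (e : ht.Edge) : ht.basis e = ht.gen e := by
  change ht.hom (FreeGroup.of e) = _
  simp [hom]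

end IsSchreierTransversal

/-! ### Words, their reduction, and the representatives of least code. -/

namespace SchreierWord

/-- The object with a given Gödel number, with a default value for numbers which are not used. -/
def ofCode (α : Type) [Encodable α] [Inhabited α] (m : ℕ) : α :=
  ((Encodable.decode (α := α) m).map fun a =>
    if Encodable.encode a = m then a else default).getD default

theorem ofCode_encode {α : Type} [Encodable α] [Inhabited α] (a : α) :
    ofCode α (Encodable.encode a) = a := by
  simp [ofCode]

theorem encode_ofCode_or {α : Type} [Encodable α] [Inhabited α] (m : ℕ) :
    Encodable.encode (ofCode α m) = m ∨ ofCode α m = default := by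
  rw [ofCode]
  cases Encodable.decode (α := α) m with
  | none => exact .inr rfl
  | some a =>
    by_cases h : Encodable.encode a = m
    · simp [h]
    · simp [h]

/-- An unused number decodes to the default `[]`, whose code is `0`. -/
theorem encode_ofCode_le (m : ℕ) :
    Encodable.encode (ofCode (List (ℕ × Bool)) m) ≤ m := by
  obtain h | h := encode_ofCode_or (α := List (ℕ × Bool)) m
  · exact h.le
  · rw [h]
    exact Nat.zero_le _

/-- The value in `F_n` of a word on the natural numbers, where the letters `≥ n` are trivial. -/
def val (n : ℕ) (w : List (ℕ × Bool)) : FreeGroup (Fin n) :=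
  FreeGroup.lift (fun i => if h : i < n then FreeGroup.of ⟨i, h⟩ else 1) (FreeGroup.mk w)

theorem val_nil (n : ℕ) : val n [] = 1 := by
  simp [val]

theorem val_append (n : ℕ) (v w : List (ℕ × Bool)) : val n (v ++ w) = val n v * val n w := by
  simp only [val, ← FreeGroup.mul_mk, map_mul]

theorem val_invRev (n : ℕ) (w : List (ℕ × Bool)) :
    val n (FreeGroup.invRev w) = (val n w)⁻¹ := by
  simp only [val, ← FreeGroup.inv_mk, map_inv]

theorem val_cons (n : ℕ) (x : ℕ × Bool) (w : List (ℕ × Bool)) :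
    val n (x :: w) = val n [x] * val n w :=
  val_append n [x] w

theorem val_singleton_of_lt {n : ℕ} (a : Fin n) (b : Bool) :
    val n [((a : ℕ), b)] = FreeGroup.mk [(a, b)] := by
  cases b <;> simp [val, FreeGroup.of, FreeGroup.inv_mk, FreeGroup.invRev]

theorem val_singleton_of_le {n i : ℕ} (h : n ≤ i) (b : Bool) : val n [(i, b)] = 1 := by
  cases b <;> simp [val, h]

theorem val_map {n : ℕ} (s : List (Fin n × Bool)) :
    val n (s.map fun x => ((x.1 : ℕ), x.2)) = FreeGroup.mk s := by
  induction s with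
  | nil => exact val_nil n
  | cons x s ih =>
    rw [List.map_cons, val_cons, ih, val_singleton_of_lt, FreeGroup.mul_mk]
    rfl

/-- Left multiplication of a reduced word by a letter, followed by reduction. -/
def consReduce {α : Type} [DecidableEq α] (x : α × Bool) (r : List (α × Bool)) :
    List (α × Bool) :=
  List.casesOn r [x] fun y t => if x.1 = y.1 ∧ x.2 = !y.2 then t else x :: y :: t

theorem map_consReduce {α β : Type} [DecidableEq α] [DecidableEq β] {f : α → β}
    (hf : Function.Injective f) (x : α × Bool) (r : List (α × Bool)) :
    (consReduce x r).map (fun y => (f y.1, y.2)) =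
      consReduce (f x.1, x.2) (r.map fun y => (f y.1, y.2)) := by
  cases r with
  | nil => rfl
  | cons y t =>
    simp only [consReduce, List.map_cons, hf.eq_iff]
    split_ifs <;> rfl

theorem toWord_mk_mul {α : Type} [DecidableEq α] (x : α × Bool) (g : FreeGroup α) :
    (FreeGroup.mk [x] * g).toWord = consReduce x g.toWord := by
  conv_lhs => rw [← g.mk_toWord, FreeGroup.mul_mk, FreeGroup.toWord_mk, List.singleton_append,
    FreeGroup.reduce.cons, FreeGroup.reduce_toWord]
  rfl

/-- The reduced word of the value of a word. -/
def red (n : ℕ) (w : List (ℕ × Bool)) : List (ℕ × Bool) :=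
  w.foldr (fun x r => if x.1 < n then consReduce x r else r) []

theorem red_eq (n : ℕ) (w : List (ℕ × Bool)) :
    red n w = (val n w).toWord.map fun x => ((x.1 : ℕ), x.2) := by
  induction w with
  | nil => simp [val_nil, red]
  | cons x w ih =>
    obtain ⟨i, b⟩ := x
    rw [red, List.foldr_cons, ← red, ih, val_cons]
    split_ifs with h
    · rw [val_singleton_of_lt ⟨i, h⟩, toWord_mk_mul,
        map_consReduce (f := fun i : Fin n => (i : ℕ)) Fin.val_injective]
    · rw [val_singleton_of_le (not_lt.1 h), one_mul]

theorem elemCode_val (n : ℕ) (w : List (ℕ × Bool)) :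
    elemCode (val n w) = Encodable.encode (red n w) := by
  rw [red_eq]; rfl

theorem red_eq_nil_iff (n : ℕ) (w : List (ℕ × Bool)) : red n w = [] ↔ val n w = 1 := by
  simp [red_eq]

theorem exists_val_ofCode_eq {n : ℕ} {H : Subgroup (FreeGroup (Fin n))}
    (c : FreeGroup (Fin n) ⧸ H) :
    ∃ m, (val n (ofCode (List (ℕ × Bool)) m) : FreeGroup (Fin n) ⧸ H) = c := by
  obtain ⟨g, rfl⟩ := QuotientGroup.mk_surjective c
  obtain ⟨s, rfl⟩ := Quot.exists_rep g
  refine ⟨Encodable.encode (s.map fun x => ((x.1 : ℕ), x.2)), ?_⟩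
  rw [ofCode_encode, val_map]
  rfl

open Classical in
/-- The word of least code in a coset. -/
noncomputable def rep {n : ℕ} {H : Subgroup (FreeGroup (Fin n))} (c : FreeGroup (Fin n) ⧸ H) :
    List (ℕ × Bool) :=
  ofCode _ (Nat.find (exists_val_ofCode_eq c))

section

variable {n : ℕ} {H : Subgroup (FreeGroup (Fin n))}

theorem mk_val_rep (c : FreeGroup (Fin n) ⧸ H) :
    (val n (rep c) : FreeGroup (Fin n) ⧸ H) = c := by
  classical exact Nat.find_spec (exists_val_ofCode_eq c)

theorem encode_rep_le (w : List (ℕ × Bool)) :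
    Encodable.encode (rep (val n w : FreeGroup (Fin n) ⧸ H)) ≤ Encodable.encode w := by
  classical
  exact (encode_ofCode_le _).trans (Nat.find_min' _ (by rw [ofCode_encode]))

/-- A suffix with a smaller code in the same coset could be substituted for `w`, and would give a
smaller code for the whole word, because `Nat.pair` is strictly increasing in its second argument.
-/
theorem rep_of_cons {x : ℕ × Bool} {w : List (ℕ × Bool)}
    (h : rep (val n (x :: w) : FreeGroup (Fin n) ⧸ H) = x :: w) :
    rep (val n w : FreeGroup (Fin n) ⧸ H) = w := by
  set w' := rep (val n w : FreeGroup (Fin n) ⧸ H) with hw'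
  have hle : Encodable.encode w' ≤ Encodable.encode w := encode_rep_le w
  have hc : (val n (x :: w') : FreeGroup (Fin n) ⧸ H) = val n (x :: w) := by
    rw [val_cons, val_cons n x w, ← smul_eq_mul, ← smul_eq_mul, ← MulAction.Quotient.smul_coe,
      ← MulAction.Quotient.smul_coe, mk_val_rep]
  have h1 := encode_rep_le (n := n) (H := H) (x :: w')
  rw [hc, h, Encodable.encode_list_cons, Encodable.encode_list_cons, Nat.succ_le_succ_iff] at h1
  refine Encodable.encode_injective (le_antisymm hle (not_lt.1 fun hlt => ?_))
  exact absurd (Nat.pair_lt_pair_right _ hlt) (not_lt.2 h1)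

theorem rep_one : rep ((1 : FreeGroup (Fin n)) : FreeGroup (Fin n) ⧸ H) = [] := by
  have h := encode_rep_le (n := n) (H := H) []
  rw [val_nil, Encodable.encode_list_nil] at h
  exact Encodable.encode_injective (Nat.le_zero.1 h)

theorem mk_smul (x : Fin n × Bool) (w : List (ℕ × Bool)) :
    (FreeGroup.mk [x] • (val n w : FreeGroup (Fin n) ⧸ H) : FreeGroup (Fin n) ⧸ H) =
      val n (((x.1 : ℕ), x.2) :: w) := by
  rw [val_cons, val_singleton_of_lt, MulAction.Quotient.smul_coe, smul_eq_mul]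

theorem isSchreierTransversal :
    IsSchreierTransversal fun c : FreeGroup (Fin n) ⧸ H => val n (rep c) where
  mk_eq := mk_val_rep
  one := by rw [rep_one, val_nil]
  tree P h1 hP := by
    -- Deleting first letters descends through representatives to the empty word, hence along the
    -- tree to the base coset.
    have key (w : List (ℕ × Bool)) : rep (val n w : FreeGroup (Fin n) ⧸ H) = w →
        P (val n w : FreeGroup (Fin n) ⧸ H) := by
      induction w with
      | nil => intro; rwa [val_nil]
      | cons x w ih =>
        intro h
        have hw := rep_of_cons h
        replace ih := ih hw
        obtain ⟨i, b⟩ := x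
        obtain hi | hi := le_or_gt n i
        -- A letter `≥ n` does not change the coset.
        · rwa [val_cons, val_singleton_of_le hi, one_mul]
        · cases b
          · have h2 : FreeGroup.of (⟨i, hi⟩ : Fin n) * val n ((i, false) :: w) = val n w := by
              rw [val_cons, val_singleton_of_lt ⟨i, hi⟩ false, ← mul_assoc, FreeGroup.of,
                FreeGroup.mul_mk]
              convert one_mul _
              exact Quot.sound (FreeGroup.Red.Step.cons_not (b := true))
            have h3 : (FreeGroup.of (⟨i, hi⟩ : Fin n) • (val n ((i, false) :: w) :
                FreeGroup (Fin n) ⧸ H) : FreeGroup (Fin n) ⧸ H) = val n w := by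
              rw [MulAction.Quotient.smul_coe, smul_eq_mul, h2]
            refine (hP _ ⟨i, hi⟩ ?_).2 ?_
            · rw [h3, hw, h, h2]
            · rwa [h3]
          · have h3 := mk_smul (H := H) (⟨i, hi⟩, true) w
            rw [← FreeGroup.of] at h3
            rw [← h3]
            refine (hP _ ⟨i, hi⟩ ?_).1 ih
            rw [h3, h, hw, val_cons, val_singleton_of_lt ⟨i, hi⟩]
            rfl
    intro c
    rw [← mk_val_rep c]
    exact key _ (by rw [mk_val_rep])

/-! ### Numbering the edges outside the tree. -/

/-- A word representing the Schreier generator of the edge `e`, whose source is given by a word. -/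
noncomputable def genWord (H : Subgroup (FreeGroup (Fin n))) (e : List (ℕ × Bool) × ℕ) :
    List (ℕ × Bool) :=
  FreeGroup.invRev (rep (val n ((e.2, true) :: e.1) : FreeGroup (Fin n) ⧸ H)) ++
    (e.2, true) :: e.1

theorem gen_eq_val_genWord (e : (FreeGroup (Fin n) ⧸ H) × Fin n) :
    ((isSchreierTransversal (H := H)).gen e : FreeGroup (Fin n)) =
      val n (genWord H (rep e.1, e.2)) := by
  have h := mk_smul (H := H) (e.2, true) (rep e.1)
  rw [mk_val_rep] at h
  rw [genWord, val_append, val_invRev, ← h, val_cons, val_singleton_of_lt]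
  rfl

/-- The number `m` codes an edge outside the tree. -/
def IsEdge (H : Subgroup (FreeGroup (Fin n))) (m : ℕ) : Prop :=
  Encodable.encode (ofCode (List (ℕ × Bool) × ℕ) m) = m ∧
    rep (val n (ofCode (List (ℕ × Bool) × ℕ) m).1 : FreeGroup (Fin n) ⧸ H) =
      (ofCode (List (ℕ × Bool) × ℕ) m).1 ∧
    val n (genWord H (ofCode (List (ℕ × Bool) × ℕ) m)) ≠ 1

/-- The code of an edge. -/
noncomputable def edgeCode (e : (FreeGroup (Fin n) ⧸ H) × Fin n) : ℕ :=
  Encodable.encode (rep e.1, (e.2 : ℕ))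

theorem edgeCode_injective : Function.Injective (edgeCode (H := H)) := by
  rintro ⟨c, a⟩ ⟨c', a'⟩ h
  have h1 := Encodable.encode_injective h
  rw [Prod.mk.injEq] at h1
  exact Prod.ext (by simpa only [mk_val_rep] using congrArg (fun w =>
    (val n w : FreeGroup (Fin n) ⧸ H)) h1.1) (Fin.val_injective h1.2)

theorem isEdge_edgeCode_iff (e : (FreeGroup (Fin n) ⧸ H) × Fin n) :
    IsEdge H (edgeCode e) ↔ (isSchreierTransversal (H := H)).gen e ≠ 1 := by
  unfold IsEdge edgeCode
  rw [ofCode_encode, ← gen_eq_val_genWord, mk_val_rep]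
  simp

theorem exists_edgeCode_eq {m : ℕ} (hm : IsEdge H m) :
    ∃ e : (isSchreierTransversal (H := H)).Edge, edgeCode e.1 = m := by
  obtain ⟨⟨w, i⟩, rfl⟩ : ∃ p : List (ℕ × Bool) × ℕ, Encodable.encode p = m :=
    ⟨_, hm.1⟩
  have hm' := hm
  rw [IsEdge, ofCode_encode] at hm'
  obtain ⟨-, h1, h2⟩ := hm'
  -- For `i ≥ n` the edge would be a loop with trivial generator.
  have hi : i < n := by
    by_contra hi
    refine h2 ?_
    rw [genWord, val_append, val_invRev, val_cons, val_singleton_of_le (not_lt.1 hi), one_mul, h1,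
      inv_mul_cancel]
  have h3 : edgeCode ((val n w : FreeGroup (Fin n) ⧸ H), (⟨i, hi⟩ : Fin n)) =
      Encodable.encode (w, i) := by
    rw [edgeCode, h1]
  exact ⟨⟨_, (isEdge_edgeCode_iff _).1 (h3 ▸ hm)⟩, h3⟩

open Classical in
/-- The index in the enumeration of the edge with code `m`. -/
noncomputable def edgeIndex (H : Subgroup (FreeGroup (Fin n))) (m : ℕ) : ℕ :=
  Nat.count (IsEdge H) m

theorem edgeIndex_injOn {m m' : ℕ} (hm : IsEdge H m) (hm' : IsEdge H m')
    (h : edgeIndex H m = edgeIndex H m') : m = m' := by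
  classical exact Nat.count_injective hm hm' h

/-- More than `k` edge codes lie below `m + 1`, so `Nat.nth` at `k` is an edge code even when there
are finitely many edges. -/
theorem exists_edgeIndex_eq {m k : ℕ} (hk : k ≤ edgeIndex H m) (hm : IsEdge H m) :
    ∃ m', IsEdge H m' ∧ edgeIndex H m' = k := by
  classical
  have hlt : k < Nat.count (IsEdge H) (m + 1) := by
    rw [Nat.count_succ, if_pos hm]
    exact Nat.lt_succ_of_le hk
  have hf : ∀ hf : {m | IsEdge H m}.Finite, k < hf.toFinset.card := fun hf =>
    hlt.trans_le (Nat.count_le_card hf _)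
  exact ⟨Nat.nth (IsEdge H) k, Nat.nth_mem k hf, Nat.count_nth hf⟩

/-- The index of an edge outside the tree. -/
noncomputable def index (e : (isSchreierTransversal (H := H)).Edge) : ℕ :=
  edgeIndex H (edgeCode e.1)

theorem index_injective : Function.Injective (index (H := H)) := fun e e' h =>
  Subtype.ext (edgeCode_injective (edgeIndex_injOn ((isEdge_edgeCode_iff _).2 e.2)
    ((isEdge_edgeCode_iff _).2 e'.2) h))

theorem isLowerSet_range_index : IsLowerSet (Set.range (index (H := H))) := by
  rintro _ k hk ⟨e, rfl⟩
  obtain ⟨m, hm, rfl⟩ := exists_edgeIndex_eq hk ((isEdge_edgeCode_iff _).2 e.2)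
  obtain ⟨e', rfl⟩ := exists_edgeCode_eq hm
  exact ⟨e', rfl⟩

end

end SchreierWord

/-! ### Partial recursive folds and searches. -/

theorem Partrec.list_foldr {α β σ : Type} [Primcodable α] [Primcodable β] [Primcodable σ]
    {f : α → List β} {g : α → σ} {h : α → β × σ →. σ} (hf : Computable f) (hg : Computable g)
    (hh : Partrec₂ h) :
    Partrec fun a => (f a).foldr (fun b s => s.bind fun s => h a (b, s)) (Part.some (g a)) := by
  have hstep : Partrec₂ fun (a : α) (q : ℕ × σ) =>
      (Option.casesOn (f a).reverse[q.1]? (Part.some q.2) fun b => h a (b, q.2) : Part σ) := by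
    refine Partrec.optionCasesOn_right (α := α × (ℕ × σ)) (β := β) (σ := σ)
      (o := fun r => (f r.1).reverse[r.2.1]?) (f := fun r => r.2.2)
      (g := fun r b => h r.1 (b, r.2.2)) ?_ ?_ ?_
    · exact Computable.list_getElem?.comp
        (Computable.list_reverse.comp (hf.comp Computable.fst)) (Computable.fst.comp Computable.snd)
    · exact Computable.snd.comp Computable.snd
    · exact hh.comp (Computable.fst.comp Computable.fst)
        (Computable.pair Computable.snd
          (Computable.snd.comp (Computable.snd.comp Computable.fst)))
  refine (Partrec.nat_rec (Computable.list_length.comp hf) hg.partrec hstep).of_eq fun a => ?_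
  -- The first `l.length` steps read only `l.reverse`; the arbitrary tail `t` absorbs the letter
  -- which reversal moves to the end.
  have key (l : List β) : ∀ t : List β,
      (Nat.rec (Part.some (g a)) (fun y IH => IH.bind fun s =>
        (Option.casesOn (l.reverse ++ t)[y]? (Part.some s) fun b => h a (b, s) : Part σ))
        l.length : Part σ) =
      l.foldr (fun b s => s.bind fun s => h a (b, s)) (Part.some (g a)) := by
    induction l with
    | nil => intro t; rfl
    | cons x l ih =>
      intro t
      rw [List.foldr_cons, ← ih (x :: t)]
      simp [List.append_assoc]
  simpa using key (f a) []

theorem Nat.rfind_decide_eq_find {p : ℕ → Prop} [DecidablePred p] (h : ∃ m, p m) :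
    (Nat.rfind fun m => Part.some (decide (p m))) = Part.some (Nat.find h) := by
  refine Part.eq_some_iff.2 (Nat.mem_rfind.2 ⟨?_, fun hm => ?_⟩)
  · simpa using Nat.find_spec h
  · simpa using Nat.find_min h hm

/-! ### The procedures, run with an arbitrary candidate program. -/

namespace SchreierWord

/-- Partial computation of membership. -/
def memP (p : ℕ × Code) (w : List (ℕ × Bool)) : Part Bool :=
  (p.2.eval (Encodable.encode (red p.1 w))).map fun k => decide (k = 1)

/-- Partial computation of the representative of the coset of a word. -/
def repP (p : ℕ × Code) (w : List (ℕ × Bool)) : Part (List (ℕ × Bool)) :=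
  (Nat.rfind fun m => memP p (FreeGroup.invRev (ofCode _ m) ++ w)).map (ofCode _)

/-- Partial computation of the Schreier generator of an edge. -/
def genP (p : ℕ × Code) (e : List (ℕ × Bool) × ℕ) : Part (List (ℕ × Bool)) :=
  (repP p ((e.2, true) :: e.1)).map fun r =>
    red p.1 (FreeGroup.invRev r ++ (e.2, true) :: e.1)

/-- Partial decision of whether a number is the code of an edge outside the tree. -/
def edgeP (p : ℕ × Code) (m : ℕ) : Part Bool :=
  (repP p (ofCode (List (ℕ × Bool) × ℕ) m).1).bind fun r =>
    (genP p (ofCode _ m)).map fun g =>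
      decide (Encodable.encode (ofCode (List (ℕ × Bool) × ℕ) m) = m) &&
        (decide (r = (ofCode (List (ℕ × Bool) × ℕ) m).1) && !decide (g = []))

/-- Partial computation of the index of an edge. -/
def indexP (p : ℕ × Code) (m : ℕ) : Part ℕ :=
  Nat.rec (Part.some 0) (fun y IH => IH.bind fun i => (edgeP p y).map fun b => cond b (i + 1) i) m

/-- Partial enumeration of the Schreier basis. -/
def enumP (p : ℕ × Code) (k : ℕ) : Part ℕ :=
  (Nat.rfind fun m => (edgeP p m).bind fun d => (indexP p m).map fun j => d && decide (j = k)).bind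
    fun m => (genP p (ofCode _ m)).map Encodable.encode

/-- Rewriting of one letter. -/
def stepP (p : ℕ × Code) (q : (ℕ × Bool) × (List (ℕ × Bool) × List (ℕ × Bool))) :
    Part (List (ℕ × Bool) × List (ℕ × Bool)) :=
  (repP p (q.1 :: q.2.1)).bind fun r =>
    (genP p (cond q.1.2 q.2.1 r, q.1.1)).bind fun g =>
      (indexP p (Encodable.encode (cond q.1.2 q.2.1 r, q.1.1))).map fun j =>
        (r, cond (decide (g = [])) q.2.2 ((j, q.1.2) :: q.2.2))

/-- Rewriting of a word. -/
def rewriteP (p : ℕ × Code) (w : List (ℕ × Bool)) : Part (List (ℕ × Bool) × List (ℕ × Bool)) :=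
  w.foldr (fun x s => s.bind fun s => stepP p (x, s)) (Part.some ([], []))

/-- Partial rewriting of codes of words. -/
def exprP (p : ℕ × Code) (k : ℕ) : Part ℕ :=
  (rewriteP p (ofCode _ k)).map fun s => Encodable.encode s.2

/-! ### The procedures are partial recursive. -/

section computability

open Computable

theorem primrec_ofCode {α : Type} [Primcodable α] [Inhabited α] : Primrec (ofCode α) := by
  classical
  refine Primrec.option_getD.comp (Primrec.option_map Primrec.decode ?_) (Primrec.const default)
  exact Primrec.ite (Primrec.eq.comp (Primrec.encode.comp Primrec.snd) Primrec.fst) Primrec.snd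
    (Primrec.const _)

theorem primrec_consReduce {α : Type} [DecidableEq α] [Primcodable α] :
    Primrec₂ (consReduce : α × Bool → List (α × Bool) → List (α × Bool)) := by
  refine (Primrec.list_casesOn (α := (α × Bool) × List (α × Bool)) (f := fun q => q.2)
    (g := fun q => [q.1])
    (h := fun q z => if q.1.1 = z.1.1 ∧ q.1.2 = !z.1.2 then z.2 else q.1 :: z.1 :: z.2)
    Primrec.snd (Primrec.list_cons.comp Primrec.fst (Primrec.const [])) ?_).of_eq fun q => ?_
  · refine Primrec.ite (PrimrecPred.and (Primrec.eq.comp ?_ ?_) (Primrec.eq.comp ?_ ?_)) ?_ ?_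
    · exact Primrec.fst.comp (Primrec.fst.comp Primrec.fst)
    · exact Primrec.fst.comp (Primrec.fst.comp Primrec.snd)
    · exact Primrec.snd.comp (Primrec.fst.comp Primrec.fst)
    · exact Primrec.not.comp (Primrec.snd.comp (Primrec.fst.comp Primrec.snd))
    · exact Primrec.snd.comp Primrec.snd
    · exact Primrec.list_cons.comp (Primrec.fst.comp Primrec.fst)
        (Primrec.list_cons.comp (Primrec.fst.comp Primrec.snd) (Primrec.snd.comp Primrec.snd))
  · cases q.2 <;> rfl

theorem primrec_red : Primrec₂ red := by
  refine Primrec.list_foldr (α := ℕ × List (ℕ × Bool)) (f := fun q => q.2) (g := fun _ => [])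
    (h := fun q z => if z.1.1 < q.1 then consReduce z.1 z.2 else z.2)
    Primrec.snd (Primrec.const _) ?_
  refine Primrec.ite (Primrec.nat_lt.comp ?_ ?_) ?_ ?_
  · exact Primrec.fst.comp (Primrec.fst.comp Primrec.snd)
  · exact Primrec.fst.comp Primrec.fst
  · exact primrec_consReduce.comp (Primrec.fst.comp Primrec.snd) (Primrec.snd.comp Primrec.snd)
  · exact Primrec.snd.comp Primrec.snd

theorem primrec_invRev {α : Type} [Primcodable α] : Primrec (FreeGroup.invRev (α := α)) :=
  Primrec.list_reverse.comp (Primrec.list_map Primrec.id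
    ((Primrec.fst.comp Primrec.snd).pair (Primrec.not.comp (Primrec.snd.comp Primrec.snd))).to₂)

theorem computable_decide_eq {α β : Type} [DecidableEq β] [Primcodable α] [Primcodable β]
    {f g : α → β} (hf : Computable f) (hg : Computable g) :
    Computable fun a => decide (f a = g a) :=
  (Primrec.eq (α := β)).decide.to_comp.comp hf hg

theorem partrec_memP : Partrec₂ memP := by
  refine Partrec.map (Nat.Partrec.Code.eval_part.comp (snd.comp fst)
    (Computable.encode.comp (primrec_red.to_comp.comp (fst.comp fst) snd))) ?_
  exact computable_decide_eq snd (Computable.const 1)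

theorem partrec_repP : Partrec₂ repP := by
  refine Partrec.map (Partrec.rfind ?_) (primrec_ofCode.to_comp.comp snd)
  exact partrec_memP.comp (fst.comp fst) (list_append.comp
    (primrec_invRev.to_comp.comp (primrec_ofCode.to_comp.comp snd)) (snd.comp fst))

theorem computable_edgeWord {α : Type} [Primcodable α] {f : α → List (ℕ × Bool) × ℕ}
    (hf : Computable f) : Computable fun a => ((f a).2, true) :: (f a).1 :=
  list_cons.comp ((snd.comp hf).pair (Computable.const true)) (fst.comp hf)

theorem partrec_genP : Partrec₂ genP := by
  refine Partrec.map (partrec_repP.comp fst (computable_edgeWord snd)) ?_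
  exact primrec_red.to_comp.comp (fst.comp (fst.comp fst))
    (list_append.comp (primrec_invRev.to_comp.comp snd) (computable_edgeWord (snd.comp fst)))

theorem partrec_edgeP : Partrec₂ edgeP := by
  have h : Computable (ofCode (List (ℕ × Bool) × ℕ)) := primrec_ofCode.to_comp
  refine Partrec.bind (partrec_repP.comp fst (fst.comp (h.comp snd))) ?_
  refine Partrec.map (partrec_genP.comp (fst.comp fst) (h.comp (snd.comp fst))) ?_
  refine Primrec.and.to_comp.comp (computable_decide_eq ?_ ?_) (Primrec.and.to_comp.comp
    (computable_decide_eq ?_ ?_) (Primrec.not.to_comp.comp (computable_decide_eq ?_ ?_)))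
  · exact Computable.encode.comp (h.comp (snd.comp (fst.comp fst)))
  · exact snd.comp (fst.comp fst)
  · exact snd.comp fst
  · exact fst.comp (h.comp (snd.comp (fst.comp fst)))
  · exact snd
  · exact Computable.const _

theorem partrec_indexP : Partrec₂ indexP := by
  refine Partrec.nat_rec (α := (ℕ × Code) × ℕ) (f := fun q => q.2) (g := fun _ => Part.some 0)
    (h := fun q z => (edgeP q.1 z.1).map fun b => cond b (z.2 + 1) z.2) snd
    (Computable.const 0).partrec ?_
  refine Partrec.map (partrec_edgeP.comp (fst.comp fst) (fst.comp snd)) ?_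
  exact Computable.cond snd (Computable.succ.comp (snd.comp (snd.comp fst)))
    (snd.comp (snd.comp fst))

theorem partrec_enumP : Partrec₂ enumP := by
  refine Partrec.bind (Partrec.rfind (Partrec.bind
    (partrec_edgeP.comp (fst.comp fst) snd) (Partrec.map
      (partrec_indexP.comp (fst.comp (fst.comp fst)) (snd.comp fst)) ?_))) ?_
  · exact Primrec.and.to_comp.comp (snd.comp fst)
      (computable_decide_eq snd (snd.comp (fst.comp (fst.comp fst))))
  · exact Partrec.map (partrec_genP.comp (fst.comp fst) (primrec_ofCode.to_comp.comp snd))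
      (Computable.encode.comp snd)

theorem partrec_stepP : Partrec₂ stepP := by
  refine Partrec.bind (partrec_repP.comp fst (list_cons.comp (fst.comp snd)
    (fst.comp (snd.comp snd)))) ?_
  have he : Computable fun z : ((ℕ × Code) × (ℕ × Bool) × (List (ℕ × Bool) × List (ℕ × Bool))) ×
      List (ℕ × Bool) => (cond z.1.2.1.2 z.1.2.2.1 z.2, z.1.2.1.1) :=
    (Computable.cond (snd.comp (fst.comp (snd.comp fst)))
      (fst.comp (snd.comp (snd.comp fst))) snd).pair (fst.comp (fst.comp (snd.comp fst)))
  refine Partrec.bind (partrec_genP.comp (fst.comp fst) he) (Partrec.map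
    (partrec_indexP.comp (fst.comp (fst.comp fst)) (Computable.encode.comp (he.comp fst))) ?_)
  have hq : Computable fun z : ((((ℕ × Code) × (ℕ × Bool) ×
      (List (ℕ × Bool) × List (ℕ × Bool))) × List (ℕ × Bool)) × List (ℕ × Bool)) × ℕ =>
      z.1.1.1.2 := snd.comp (fst.comp (fst.comp fst))
  refine (snd.comp (fst.comp fst)).pair (Computable.cond
    (computable_decide_eq (snd.comp fst) (Computable.const _)) (snd.comp (snd.comp hq))
    (list_cons.comp (snd.pair (snd.comp (fst.comp hq))) (snd.comp (snd.comp hq))))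

theorem partrec_exprP : Partrec₂ exprP := by
  refine Partrec.map (Partrec.list_foldr (primrec_ofCode.to_comp.comp snd)
    (Computable.const _) ?_) (Computable.encode.comp (snd.comp snd))
  exact partrec_stepP.comp (fst.comp fst) snd

/-- A partial recursive function with a parameter has programs computed from the parameter. -/
theorem exists_computable_code {α : Type} [Primcodable α] {f : α → ℕ →. ℕ} (hf : Partrec₂ f) :
    ∃ φ : α → Code, Computable φ ∧ ∀ a k, (φ a).eval k = f a k := by
  obtain ⟨c, hc⟩ := Nat.Partrec.Code.exists_code.1 hf
  refine ⟨fun a => c.curry (Encodable.encode a),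
    Nat.Partrec.Code.primrec₂_curry.to_comp.comp (Computable.const c) Computable.encode,
    fun a k => ?_⟩
  rw [Nat.Partrec.Code.eval_curry, hc]
  have : Nat.pair (Encodable.encode a) k = Encodable.encode (a, k) := rfl
  rw [this]
  simp [Part.map_id']

end computability

/-! ### The procedures are correct when the program decides membership. -/

section correctness

variable {n : ℕ} {H : Subgroup (FreeGroup (Fin n))} {c : Code} (hc : DecidesMembership c H)
include hc

open Classical in
theorem memP_eq (w : List (ℕ × Bool)) : memP (n, c) w = Part.some (decide (val n w ∈ H)) := by
  have h := hc (val n w)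
  rw [elemCode_val] at h
  by_cases hw : val n w ∈ H
  · simp [memP, h.1 hw, hw]
  · simp [memP, h.2 hw, hw]

/-- Testing `v⁻¹w ∈ H` is testing equality of left cosets, so the search stops at the same least
number that defines `rep`. -/
theorem repP_eq (w : List (ℕ × Bool)) :
    repP (n, c) w = Part.some (rep (val n w : FreeGroup (Fin n) ⧸ H)) := by
  classical
  have h (m : ℕ) : memP (n, c) (FreeGroup.invRev (ofCode _ m) ++ w) =
      Part.some (decide ((val n (ofCode (List (ℕ × Bool)) m) : FreeGroup (Fin n) ⧸ H) =
        val n w)) := by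
    rw [memP_eq hc, val_append, val_invRev]
    simp only [QuotientGroup.eq]
  simp only [repP, h]
  rw [Nat.rfind_decide_eq_find (exists_val_ofCode_eq _), Part.map_some]
  rfl

theorem genP_eq (e : List (ℕ × Bool) × ℕ) :
    genP (n, c) e = Part.some (red n (genWord H e)) := by
  rw [genP, repP_eq hc, Part.map_some]
  rfl

open Classical in
theorem edgeP_eq (m : ℕ) : edgeP (n, c) m = Part.some (decide (IsEdge H m)) := by
  simp only [edgeP, repP_eq hc, genP_eq hc, Part.bind_some, Part.map_some, red_eq_nil_iff]
  refine congrArg Part.some (Bool.eq_iff_iff.2 (Iff.trans ?_ decide_eq_true_iff.symm))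
  simp [IsEdge]

theorem indexP_eq (m : ℕ) : indexP (n, c) m = Part.some (edgeIndex H m) := by
  classical
  induction m with
  | zero => simp [indexP, edgeIndex]
  | succ m ih =>
    have : indexP (n, c) (m + 1) = (indexP (n, c) m).bind fun i =>
      (edgeP (n, c) m).map fun b => cond b (i + 1) i := rfl
    rw [this, ih, Part.bind_some, edgeP_eq hc, Part.map_some, edgeIndex, edgeIndex, Nat.count_succ]
    by_cases h : IsEdge H m <;> simp [h]

theorem enumP_eq (k : ℕ) : enumP (n, c) k =
    (Nat.rfind fun m => by classical exact Part.some (decide (IsEdge H m ∧ edgeIndex H m = k))).bind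
      fun m => Part.some (Encodable.encode (red n (genWord H (ofCode _ m)))) := by
  classical
  simp only [enumP, edgeP_eq hc, indexP_eq hc, genP_eq hc, Part.bind_some, Part.map_some,
    Bool.decide_and]

theorem enumP_index (e : (isSchreierTransversal (H := H)).Edge) :
    enumP (n, c) (index e) =
      Part.some (elemCode ((isSchreierTransversal (H := H)).gen e : FreeGroup (Fin n))) := by
  classical
  have he := (isEdge_edgeCode_iff _).2 e.2
  have h : ∃ m, IsEdge H m ∧ edgeIndex H m = index e := ⟨_, he, rfl⟩
  have hm : Nat.find h = edgeCode e.1 :=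
    edgeIndex_injOn (Nat.find_spec h).1 he (Nat.find_spec h).2
  rw [enumP_eq hc, Nat.rfind_decide_eq_find h, Part.bind_some, hm, edgeCode, ofCode_encode,
    gen_eq_val_genWord, elemCode_val]

/-- Only the search for an edge of index `k` can diverge, and it does so exactly when there is no
such edge. -/
theorem enumP_dom_iff (k : ℕ) : (enumP (n, c) k).Dom ↔ k ∈ Set.range (index (H := H)) := by
  classical
  constructor
  · intro h
    obtain ⟨y, hy⟩ := Part.dom_iff_mem.1 h
    rw [enumP_eq hc, Part.mem_bind_iff] at hy
    obtain ⟨m, hm, -⟩ := hy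
    have h1 : IsEdge H m ∧ edgeIndex H m = k := by simpa using Nat.rfind_spec hm
    obtain ⟨e, he⟩ := exists_edgeCode_eq h1.1
    exact ⟨e, by rw [index, he, h1.2]⟩
  · rintro ⟨e, rfl⟩
    rw [enumP_index hc]
    trivial

theorem rewriteP_eq (s : List (Fin n × Bool)) :
    rewriteP (n, c) (s.map fun x => ((x.1 : ℕ), x.2)) =
      Part.some (rep ((FreeGroup.mk s : FreeGroup (Fin n)) : FreeGroup (Fin n) ⧸ H),
        ((isSchreierTransversal (H := H)).rewrite s).map fun y => (index y.1, y.2)) := by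
  induction s with
  | nil =>
    rw [← FreeGroup.one_eq_mk, rep_one]
    rfl
  | cons x s ih =>
    -- The next representative depends only on the coset, so the suffix may be replaced by its
    -- representative.
    have h1 : (val n (((x.1 : ℕ), x.2) :: rep ((FreeGroup.mk s : FreeGroup (Fin n)) :
        FreeGroup (Fin n) ⧸ H)) : FreeGroup (Fin n) ⧸ H) = FreeGroup.mk (x :: s) := by
      rw [← mk_smul, mk_val_rep, MulAction.Quotient.smul_coe, smul_eq_mul, FreeGroup.mul_mk]
      rfl
    have h2 : (bif x.2 then rep ((FreeGroup.mk s : FreeGroup (Fin n)) : FreeGroup (Fin n) ⧸ H)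
        else rep ((FreeGroup.mk (x :: s) : FreeGroup (Fin n)) : FreeGroup (Fin n) ⧸ H)) =
        rep (IsSchreierTransversal.crossed H x s).1 := by
      rw [IsSchreierTransversal.crossed]
      cases x.2 <;> rfl
    have h3 : red n (genWord H (rep (IsSchreierTransversal.crossed H x s).1, (x.1 : ℕ))) = [] ↔
        (isSchreierTransversal (H := H)).gen (IsSchreierTransversal.crossed H x s) = 1 := by
      rw [red_eq_nil_iff, ← Subtype.coe_inj, gen_eq_val_genWord]
      rfl
    rw [List.map_cons, rewriteP, List.foldr_cons, ← rewriteP, ih, Part.bind_some]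
    simp only [stepP, repP_eq hc, Part.bind_some, h1, h2, genP_eq hc, indexP_eq hc, Part.map_some,
      h3]
    rw [IsSchreierTransversal.rewrite]
    split_ifs with h
    · simp only [h, decide_false, cond_false, List.map_cons]
      rfl
    · rw [not_not] at h
      simp only [h, decide_true, cond_true]

theorem exprP_eq (g : FreeGroup (Fin n)) :
    exprP (n, c) (elemCode g) = Part.some (Encodable.encode
      (((isSchreierTransversal (H := H)).rewrite g.toWord).map fun y => (index y.1, y.2))) := by
  rw [exprP, elemCode, wordCode, ofCode_encode, rewriteP_eq hc, Part.map_some]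

end correctness

end SchreierWord

/-! ### Transport of the Schreier basis to its indices. -/

open SchreierWord

/-- There is one algorithm which, given `n` and a program `c` for the membership problem of a
subgroup `H ≤ F_n`, produces a program enumerating a basis `b₀, b₁, …` (finite or infinite) of `H`
and a program expressing every element of `H` as a word on that basis. -/
theorem proposition2p1 :
    ∃ Φ : ℕ → Code → Code × Code, Computable₂ Φ ∧
      ∀ (n : ℕ) (H : Subgroup (FreeGroup (Fin n))) (c : Code), DecidesMembership c H →
        ∃ (I : Set ℕ) (B : FreeGroupBasis I H), IsLowerSet I ∧
          EnumeratesSeq (Φ n c).1 I B ∧ ExpressesIn (Φ n c).2 I B := by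
  obtain ⟨φ, hφ, hφ'⟩ := exists_computable_code partrec_enumP
  obtain ⟨ψ, hψ, hψ'⟩ := exists_computable_code partrec_exprP
  refine ⟨fun n c => (φ (n, c), ψ (n, c)), hφ.pair hψ, fun n H c hc => ?_⟩
  set ht := isSchreierTransversal (H := H)
  let e : ht.Edge ≃ Set.range (index (H := H)) := Equiv.ofInjective _ index_injective
  have hB (y : ht.Edge) : ht.basis.reindex e (e y) = ht.gen y := by
    rw [FreeGroupBasis.reindex_apply, Equiv.symm_apply_apply, ht.basis_apply]
  refine ⟨_, ht.basis.reindex e, isLowerSet_range_index, ⟨fun k => ?_, fun k => ?_⟩, fun h => ?_⟩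
  · rw [hφ', enumP_dom_iff hc]
  · obtain ⟨y, rfl⟩ := e.surjective k
    rw [hφ', hB, ← enumP_index hc]
    rfl
  · refine ⟨(ht.rewrite (h : FreeGroup (Fin n)).toWord).map fun y => (e y.1, y.2), ?_, ?_⟩
    · rw [hψ', exprP_eq hc, wordCode, List.map_map]
      rfl
    · have h1 := ht.hom_rewrite (s := (h : FreeGroup (Fin n)).toWord)
        (by rw [FreeGroup.mk_toWord]; exact h.2)
      rw [FreeGroup.mk_toWord] at h1
      refine Eq.trans ?_ (Subtype.ext h1)
      simp only [IsSchreierTransversal.hom, FreeGroup.lift_mk, List.map_map]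
      congr 1
      refine List.map_congr_left fun y _ => ?_
      simp only [Function.comp_apply, hB]
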